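/- All monoids are commutative and cancellative (with identity); $H^{\times}$ denotes the group of units of a monoid $H$. Let $K$ be a quotient group of $H$. An overmonoid of $H$ is a submonoid $T$ of $K$ with $H\subseteq T$; its root closure is $\widetilde{T}=\{x\in K\mid x^n\in T\text{ for some }n\geq 1\}$, and $T$ is root closed if $\widetilde{T}=T$. A subset $\mathfrak{a}\subseteq H$ is an $s$-ideal if $\mathfrak{a}H=\mathfrak{a}$, and $H$ is $s$-noetherian if it satisfies the ascending chain condition on $s$-ideals. A submonoid $S$ of a monoid $M$ is called inert in $M$ if for all $x,y\in M$ with $xy\in S$ there is some $\varepsilon\in M^{\times}$ with $x\varepsilon,\,y\varepsilon^{-1}\in S$. A monoid homomorphism $\theta:H\to B$ is a transfer homomorphism if $B=\theta(H)B^{\times}$, $\theta^{-1}(B^{\times})=H^{\times}$, and whenever $u\in H$, $b,c\in B$ and $\theta(u)=bc$, there are $v,w\in H$ and $\varepsilon,\eta\in B^{\times}$ with $u=vw$, $\theta(v)=b\varepsilon$ and $\theta(w)=c\eta$. A Krull monoid is a monoid $B$, with quotient group $L$ say, that is completely integrally closed (every $x\in L$ for which some $c\in B$ satisfies $cx^n\in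 B$ for all $n\geq 1$ lies in $B$) and satisfies the ascending chain condition on $t$-ideals; here, with $(X:Y)=\{z\in L\mid zY\subseteq X\}$, a $t$-ideal is a subset $A\subseteq B$ such that $A=\bigcup_{E}(B:(B:E))$, where $E$ ranges over the finite subsets of $A$. Finally, $H$ is called transfer Krull if there is a transfer homomorphism from $H$ to some Krull monoid. **Proposition.** Let $H$ be an $s$-noetherian monoid. The following statements are equivalent. 1. $H$ is transfer Krull. 2. There is some root closed overmonoid $T$ of $H$ such that the inclusion $H\hookrightarrow T$ is a transfer homomorphism. 3. There is some overmonoid $T$ of $H$ such that $T\subseteq\widetilde{T}$ is inert and the inclusion $H\hookrightarrow T$ is a transfer homomorphism. -/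

import Mathlib

open scoped Pointwise

universe u v

namespace TransferKrull

/-! Throughout, a monoid is commutative and cancellative. The quotient group of a monoid `H` is
`Algebra.GrothendieckGroup H`, in which `H` embeds through `Algebra.GrothendieckGroup.of`. -/

/-! ### Ideals and the s-noetherian property -/

/-- An `s`-ideal of `H` is a subset `A` (possibly empty) with `A H = A`. -/
def IsSIdeal {H : Type*} [CommMonoid H] (A : Set H) : Prop :=
  A * Set.univ = A

/-- `H` is `s`-noetherian: ascending chain condition on `s`-ideals, ordered by inclusion. -/
def IsSNoetherian (H : Type*) [CommMonoid H] : Prop :=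
  WellFoundedGT {A : Set H // IsSIdeal A}

/-! ### Closures inside the quotient group

In this section `S` is a submonoid of the group `K`, and `K` is to be thought of as the quotient
group of `S`: every element of `K` is a quotient of two elements of `S`. -/

section Closures

variable {K : Type*} [CommGroup K]

/-- The root closure `{x ∈ K | x ^ n ∈ S for some n ≥ 1}`. -/
def rootClosure (S : Submonoid K) : Submonoid K where
  carrier := {x | ∃ n : ℕ, 0 < n ∧ x ^ n ∈ S}
  one_mem' := ⟨1, one_pos, by simp⟩
  mul_mem' := by
    rintro x y ⟨n, hn, hx⟩ ⟨m, hm, hy⟩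
    refine ⟨n * m, Nat.mul_pos hn hm, ?_⟩
    rw [mul_pow]
    refine S.mul_mem ?_ ?_
    · rw [pow_mul]
      exact S.pow_mem hx m
    · rw [mul_comm n m, pow_mul]
      exact S.pow_mem hy n

def IsRootClosed (S : Submonoid K) : Prop :=
  rootClosure S = S

/-- The complete integral closure
`{x ∈ K | there is c ∈ S with c x ^ n ∈ S for all n ≥ 1}`. -/
def completeIntegralClosure (S : Submonoid K) : Set K :=
  {x | ∃ c ∈ S, ∀ n : ℕ, 0 < n → c * x ^ n ∈ S}

def IsCompletelyIntegrallyClosed (S : Submonoid K) : Prop :=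
  completeIntegralClosure S = S

/-- The colon set `(A : B) = {z ∈ K | z B ⊆ A}`. -/
def colon (A B : Set K) : Set K :=
  {z | ∀ b ∈ B, z * b ∈ A}

/-- `A_v = (A⁻¹)⁻¹`, where `A⁻¹ = (S : A)`. -/
def vClosure (S : Submonoid K) (A : Set K) : Set K :=
  colon S (colon S A)

/-- `A_t` is the union of the sets `E_v`, where `E` ranges over the finite subsets of `A`. -/
def tClosure (S : Submonoid K) (A : Set K) : Set K :=
  {x | ∃ E : Set K, E.Finite ∧ E ⊆ A ∧ x ∈ vClosure S E}

/-- A `t`-ideal of `S` is a subset `A ⊆ S` with `A_t = A`. -/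
def IsTIdeal (S : Submonoid K) (A : Set K) : Prop :=
  A ⊆ S ∧ tClosure S A = A

/-- `S` is Mori: ascending chain condition on `t`-ideals, ordered by inclusion. -/
def IsMori (S : Submonoid K) : Prop :=
  WellFoundedGT {A : Set K // IsTIdeal S A}

end Closures

/-! ### Krull monoids, transfer homomorphisms, inert extensions -/

/-- The copy of `H` inside its quotient group. -/
abbrev image (H : Type*) [CommMonoid H] : Submonoid (Algebra.GrothendieckGroup H) :=
  MonoidHom.mrange (Algebra.GrothendieckGroup.of (M := H))

/-- A Krull monoid is a completely integrally closed Mori monoid. -/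
structure IsKrull (B : Type*) [CommMonoid B] : Prop where
  completelyIntegrallyClosed : IsCompletelyIntegrallyClosed (image B)
  mori : IsMori (image B)

/-- Transfer homomorphisms: `B = θ(H) Bˣ`, `θ⁻¹(Bˣ) = Hˣ`, and factorizations of `θ(u)` in `B`
lift to factorizations of `u` in `H`, up to units of `B`. -/
structure IsTransferHom {H B : Type*} [CommMonoid H] [CommMonoid B] (θ : H →* B) : Prop where
  exists_mul_unit : ∀ b : B, ∃ a : H, ∃ ε : Bˣ, b = θ a * ε
  isUnit_iff : ∀ a : H, IsUnit (θ a) ↔ IsUnit a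
  lift_mul : ∀ (u : H) (b c : B), θ u = b * c →
    ∃ (x y : H) (ε η : Bˣ), u = x * y ∧ θ x = b * ε ∧ θ y = c * η

/-- `H` is transfer Krull: there is a transfer homomorphism from `H` to some Krull monoid `B`
(in a universe that may be larger than the one of `H`). -/
def IsTransferKrull (H : Type u) [CommMonoid H] : Prop :=
  ∃ (B : Type (max u v)) (_ : CommMonoid B) (_ : IsCancelMul B) (θ : H →* B),
    IsKrull B ∧ IsTransferHom θ

/-- The extension `S ⊆ M` is inert. -/
def IsInert {M : Type*} [CommMonoid M] (S : Submonoid M) : Prop :=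
  ∀ x y : M, x * y ∈ S → ∃ ε : Mˣ, x * (ε : M) ∈ S ∧ y * ((ε⁻¹ : Mˣ) : M) ∈ S

/-- The inclusion `T ⊆ rootClosure T` is inert: `T`, as a submonoid of the monoid
`rootClosure T`. -/
def IsInertInRootClosure {K : Type*} [CommGroup K] (T : Submonoid K) : Prop :=
  IsInert (T.comap (rootClosure T).subtype)

/-- An overmonoid of `H`: a submonoid of the quotient group of `H` that contains `H`. -/
def IsOvermonoid (H : Type*) [CommMonoid H] (T : Submonoid (Algebra.GrothendieckGroup H)) : Prop :=
  image H ≤ T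

/-- The inclusion `H ↪ T` of `H` into an overmonoid `T`. -/
def inclusion {H : Type*} [CommMonoid H] (T : Submonoid (Algebra.GrothendieckGroup H))
    (hT : IsOvermonoid H T) : H →* T :=
  (Algebra.GrothendieckGroup.of (M := H)).codRestrict T fun a => hT ⟨a, rfl⟩

end TransferKrull

namespace TransferKrull

open Algebra

/-! A transfer homomorphism from `H` to a Krull monoid `B` extends to quotient groups, and the
preimage `T` of `B` inherits root closedness. Elements of the quotient group of `H` lying over units
of `B` are units of `T`, so factorizations in `T` lift to `H` (`IsTransferHom.exists_isRootClosed`).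
Conversely, the `s`-noetherian property passes along transfer homomorphisms, and a root closed
`s`-noetherian monoid is Krull. An inert `T` is replaced by its root closure, since inertness makes
that inclusion a transfer homomorphism and these compose. -/

theorem of_injective (M : Type*) [CommMonoid M] [IsCancelMul M] :
    Function.Injective (GrothendieckGroup.of (M := M)) := by
  intro a b h
  obtain ⟨c, hc⟩ := (Localization.monoidOf (⊤ : Submonoid M)).exists_of_eq h
  exact mul_left_cancel hc

theorem exists_eq_div (M : Type*) [CommMonoid M] (x : GrothendieckGroup M) :
    ∃ a b : M, x = GrothendieckGroup.of a / GrothendieckGroup.of b := by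
  obtain ⟨⟨a, b⟩, h⟩ := (Localization.monoidOf (⊤ : Submonoid M)).surj x
  exact ⟨a, b, eq_div_of_mul_eq' h⟩

/-! ### s-noetherian monoids -/

theorem isSIdeal_iff {H : Type*} [CommMonoid H] {A : Set H} :
    IsSIdeal A ↔ ∀ a ∈ A, ∀ h : H, a * h ∈ A := by
  refine ⟨fun hA a ha h => ?_, fun hA => ?_⟩
  · have : a * h ∈ A * Set.univ := Set.mul_mem_mul ha trivial
    rwa [hA] at this
  · refine Set.Subset.antisymm ?_ fun a ha => ⟨a, ha, 1, trivial, mul_one a⟩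
    rintro _ ⟨a, ha, h, -, rfl⟩
    exact hA a ha h

/-- Since `s`-ideals are stable under units and `B = θ(H) Bˣ`, an `s`-ideal of `B` is determined by
its preimage in `H`. -/
theorem IsTransferHom.isSNoetherian {H B : Type*} [CommMonoid H] [CommMonoid B] {θ : H →* B}
    (hθ : IsTransferHom θ) (hH : IsSNoetherian H) : IsSNoetherian B := by
  have hH' : WellFoundedGT {A : Set H // IsSIdeal A} := hH
  let f : {A : Set B // IsSIdeal A} → {A : Set H // IsSIdeal A} := fun A =>
    ⟨θ ⁻¹' A.1, isSIdeal_iff.2 fun a ha h => by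
      simpa using isSIdeal_iff.1 A.2 _ ha (θ h)⟩
  have hle : ∀ A A' : {A : Set B // IsSIdeal A}, f A ≤ f A' → A ≤ A' := by
    intro A A' h b hb
    obtain ⟨a, ε, rfl⟩ := hθ.exists_mul_unit b
    refine isSIdeal_iff.1 A'.2 _ (h ?_) ε
    have := isSIdeal_iff.1 A.2 _ hb ((ε⁻¹ : Bˣ) : B)
    rwa [Units.mul_inv_cancel_right] at this
  have hf : StrictMono f := Monotone.strictMono_of_injective
    (fun A A' h => Set.preimage_mono h)
    (fun A A' h => le_antisymm (hle _ _ h.le) (hle _ _ h.ge))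
  exact hf.wellFoundedGT

/-- Every `t`-ideal is an `s`-ideal, because `{a}_v` contains all multiples of `a`. -/
theorem IsSNoetherian.isMori {T : Type*} [CommMonoid T] (hT : IsSNoetherian T) :
    IsMori (image T) := by
  have hT' : WellFoundedGT {A : Set T // IsSIdeal A} := hT
  let f : {A : Set (GrothendieckGroup T) // IsTIdeal (image T) A} →
      {A : Set T // IsSIdeal A} := fun A =>
    ⟨GrothendieckGroup.of ⁻¹' A.1, isSIdeal_iff.2 fun a ha t => by
      rw [Set.mem_preimage, ← A.2.2]
      refine ⟨{GrothendieckGroup.of a}, Set.finite_singleton _,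
        Set.singleton_subset_iff.2 ha, fun z hz => ?_⟩
      have h := mul_mem (hz _ rfl) (⟨t, rfl⟩ : GrothendieckGroup.of t ∈ image T)
      rw [map_mul, mul_comm, ← mul_assoc]
      exact h⟩
  have hle : ∀ A A', f A ≤ f A' → A ≤ A' := by
    intro A A' h x hx
    obtain ⟨t, rfl⟩ := A.2.1 hx
    exact h hx
  have hf : StrictMono f := Monotone.strictMono_of_injective
    (fun A A' h => Set.preimage_mono h)
    (fun A A' h => le_antisymm (hle _ _ h.le) (hle _ _ h.ge))
  exact hf.wellFoundedGT

/-- The `s`-ideals generated by `c, c x, …, c x ^ n` stabilize, so some `c x ^ (n + 1)` is a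
multiple of `c x ^ i` with `i ≤ n`. Cancelling puts a positive power of `x` in `T`, and `hroot`,
which is root closedness phrased inside `T`, applies. -/
theorem IsSNoetherian.isCompletelyIntegrallyClosed {T : Type*} [CommMonoid T] [IsCancelMul T]
    (hT : IsSNoetherian T)
    (hroot : ∀ (a b t : T) (n : ℕ), 0 < n → a ^ n = b ^ n * t → ∃ s, a = b * s) :
    IsCompletelyIntegrallyClosed (image T) := by
  have hT' : WellFoundedGT {A : Set T // IsSIdeal A} := hT
  refine Set.Subset.antisymm ?_ fun x hx => ⟨1, one_mem _, fun n _ => ?_⟩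
  · rintro x ⟨c, hc, hx⟩
    have hx' : ∀ n : ℕ, ∃ t : T, GrothendieckGroup.of t = c * x ^ n := by
      intro n
      rcases n.eq_zero_or_pos with rfl | hn
      · simpa using hc
      · exact hx n hn
    choose g hg using hx'
    let A : ℕ →o {A : Set T // IsSIdeal A} :=
      { toFun := fun n => ⟨{y | ∃ i ≤ n, g i ∣ y}, isSIdeal_iff.2 fun a ⟨i, hi, ha⟩ t =>
          ⟨i, hi, ha.mul_right t⟩⟩
        monotone' := fun m n hmn y ⟨i, hi, hy⟩ => ⟨i, hi.trans hmn, hy⟩ }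
    obtain ⟨n, hn⟩ := WellFoundedGT.monotone_chain_condition A
    have hmem : g (n + 1) ∈ (A n).1 := by
      rw [hn (n + 1) n.le_succ]
      exact ⟨n + 1, le_rfl, dvd_rfl⟩
    obtain ⟨i, hi, t, ht⟩ := hmem
    obtain ⟨a, b, rfl⟩ := exists_eq_div T x
    have hpow : (GrothendieckGroup.of a / GrothendieckGroup.of b) ^ (n + 1 - i) =
        GrothendieckGroup.of t := by
      have h := congrArg GrothendieckGroup.of ht
      rw [map_mul, hg, hg, mul_assoc, mul_right_inj] at h
      rw [← mul_right_inj ((GrothendieckGroup.of a / GrothendieckGroup.of b) ^ i), ← h,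
        ← pow_add]
      congr 1
      omega
    obtain ⟨s, rfl⟩ := hroot a b t (n + 1 - i) (by omega) <| of_injective T <| by
      rw [map_mul, map_pow, map_pow, ← hpow, div_pow, mul_div_cancel]
    exact ⟨s, by rw [map_mul, mul_div_cancel_left]⟩
  · rw [one_mul]
    exact pow_mem hx n

/-! ### Root closed submonoids -/

theorem le_rootClosure {K : Type*} [CommGroup K] (S : Submonoid K) : S ≤ rootClosure S :=
  fun x hx => ⟨1, one_pos, by simpa using hx⟩

theorem isRootClosed_iff {K : Type*} [CommGroup K] {S : Submonoid K} :
    IsRootClosed S ↔ ∀ (x : K) (n : ℕ), 0 < n → x ^ n ∈ S → x ∈ S := by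
  refine ⟨fun h x n hn hx => ?_, fun h => le_antisymm ?_ (le_rootClosure S)⟩
  · rw [← h]
    exact ⟨n, hn, hx⟩
  · rintro x ⟨n, hn, hx⟩
    exact h x n hn hx

theorem isRootClosed_rootClosure {K : Type*} [CommGroup K] (S : Submonoid K) :
    IsRootClosed (rootClosure S) := by
  refine isRootClosed_iff.2 ?_
  rintro x n hn ⟨m, hm, hx⟩
  exact ⟨n * m, Nat.mul_pos hn hm, by rwa [pow_mul]⟩

theorem IsCompletelyIntegrallyClosed.isRootClosed {B : Type*} [CommMonoid B]
    (hB : IsCompletelyIntegrallyClosed (image B)) : IsRootClosed (image B) := by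
  refine isRootClosed_iff.2 fun x n hn hx => ?_
  change x ∈ (image B : Set (GrothendieckGroup B))
  rw [← hB]
  obtain ⟨a, b, rfl⟩ := exists_eq_div B x
  have hα : GrothendieckGroup.of a ∈ image B := ⟨a, rfl⟩
  have hβ : GrothendieckGroup.of b ∈ image B := ⟨b, rfl⟩
  generalize GrothendieckGroup.of a = α at *
  generalize GrothendieckGroup.of b = β at *
  -- `β ^ n` clears the denominators of all powers: modulo powers of `x ^ n`, only exponents below
  -- `n` remain.
  refine ⟨β ^ n, pow_mem hβ n, fun k _ => ?_⟩
  have hle : k % n ≤ n := (Nat.mod_lt k hn).le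
  have h : β ^ n * (α / β) ^ k =
      ((α / β) ^ n) ^ (k / n) * (β ^ (n - k % n) * α ^ (k % n)) := by
    conv_lhs => rw [← Nat.div_add_mod k n, pow_add, pow_mul, ← Nat.sub_add_cancel hle,
      pow_add β, Nat.sub_add_cancel hle]
    rw [div_pow α β (k % n), mul_left_comm, mul_assoc, mul_div_cancel]
  rw [h]
  exact mul_mem (pow_mem hx _) (mul_mem (pow_mem hβ _) (pow_mem hα _))

/-! ### Transfer homomorphisms -/

theorem IsTransferHom.comp {H B C : Type*} [CommMonoid H] [CommMonoid B] [CommMonoid C]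
    {φ : B →* C} {θ : H →* B} (hφ : IsTransferHom φ) (hθ : IsTransferHom θ) :
    IsTransferHom (φ.comp θ) where
  exists_mul_unit c := by
    obtain ⟨b, ε, rfl⟩ := hφ.exists_mul_unit c
    obtain ⟨a, η, rfl⟩ := hθ.exists_mul_unit b
    exact ⟨a, Units.map φ η * ε, by simp [mul_assoc]⟩
  isUnit_iff a := (hφ.isUnit_iff _).trans (hθ.isUnit_iff a)
  lift_mul u b c h := by
    obtain ⟨x, y, ε, η, hxy, rx, ry⟩ := hφ.lift_mul (θ u) b c h
    obtain ⟨v, w, ε', η', hvw, rv, rw'⟩ := hθ.lift_mul u x y hxy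
    exact ⟨v, w, ε * Units.map φ ε', η * Units.map φ η', hvw,
      by simp [rv, rx, mul_assoc], by simp [rw', ry, mul_assoc]⟩

theorem isTransferHom_mulEquiv {B C : Type*} [CommMonoid B] [CommMonoid C] (e : B ≃* C) :
    IsTransferHom (e : B →* C) where
  exists_mul_unit c := ⟨e.symm c, 1, by simp⟩
  isUnit_iff a := MulEquiv.isUnit_map e
  lift_mul u b c h := ⟨e.symm b, e.symm c, 1, 1,
    e.injective (by simpa using h), by simp, by simp⟩

/-- The inclusion of a submonoid into its root closure is a transfer homomorphism if it is
inert. -/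
theorem IsInertInRootClosure.isTransferHom {K : Type*} [CommGroup K] {T : Submonoid K}
    (hT : IsInertInRootClosure T) :
    IsTransferHom (Submonoid.inclusion (le_rootClosure T)) where
  exists_mul_unit b := by
    obtain ⟨x, n, hn, hx⟩ := b
    let b : rootClosure T := ⟨x, n, hn, hx⟩
    -- Inertness applied to the factorization `b * b ^ (n - 1)` of an element of `T` moves `b` into
    -- `T` by a unit.
    obtain ⟨ε, h, -⟩ := hT b (b ^ (n - 1)) (by
      rw [← pow_succ', Nat.sub_add_cancel hn]
      exact hx)
    exact ⟨⟨_, h⟩, ε⁻¹, (Units.mul_inv_cancel_right b ε).symm⟩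
  isUnit_iff a := by
    refine ⟨fun h => ?_, fun h => h.map _⟩
    obtain ⟨⟨y, n, hn, hy⟩, h⟩ := isUnit_iff_exists_inv.1 h
    have h' : (a : K) * y = 1 := congrArg Subtype.val h
    -- The inverse `y` equals `a ^ (n - 1) * y ^ n`, whose factors lie in `T`.
    refine IsUnit.of_mul_eq_one (a ^ (n - 1) * ⟨y ^ n, hy⟩) (Subtype.ext ?_)
    change (a : K) * ((a : K) ^ (n - 1) * y ^ n) = 1
    rw [← mul_assoc, ← pow_succ', Nat.sub_add_cancel hn, ← mul_pow, h', one_pow]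
  lift_mul u b c h := by
    obtain ⟨ε, hb, hc⟩ := hT b c (by
      rw [← h]
      exact u.2)
    refine ⟨⟨_, hb⟩, ⟨_, hc⟩, ε, ε⁻¹, Subtype.ext ?_, rfl, rfl⟩
    have h' : b * ε * (c * ((ε⁻¹ : (rootClosure T)ˣ) : rootClosure T)) = b * c := by
      rw [mul_mul_mul_comm, Units.mul_inv, mul_one]
    exact (congrArg Subtype.val (h'.trans h.symm)).symm

theorem IsRootClosed.isInertInRootClosure {K : Type*} [CommGroup K] {T : Submonoid K}
    (hT : IsRootClosed T) : IsInertInRootClosure T := by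
  have h : ∀ x : rootClosure T, (x : K) ∈ T := fun x => (le_of_eq hT) x.2
  exact fun x y _ => ⟨1, h (x * 1), h (y * 1)⟩

/-- A transfer Krull monoid has a root closed overmonoid: the preimage of the Krull monoid under
the induced homomorphism of quotient groups. -/
theorem IsTransferHom.exists_isRootClosed {H : Type*} [CommMonoid H] {B : Type*}
    [CommMonoid B] [IsCancelMul B] {θ : H →* B} (hB : IsRootClosed (image B))
    (hθ : IsTransferHom θ) :
    ∃ (T : Submonoid (GrothendieckGroup H)) (hT : IsOvermonoid H T),
      IsRootClosed T ∧ IsTransferHom (inclusion T hT) := by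
  let φ : GrothendieckGroup H →* GrothendieckGroup B :=
    GrothendieckGroup.lift (GrothendieckGroup.of.comp θ)
  have hφ (a : H) : φ (GrothendieckGroup.of a) = GrothendieckGroup.of (θ a) :=
    DFunLike.congr_fun (GrothendieckGroup.lift.symm_apply_apply (GrothendieckGroup.of.comp θ)) a
  let T := (image B).comap φ
  have hT : IsOvermonoid H T := by
    rintro _ ⟨a, rfl⟩
    exact ⟨θ a, (hφ a).symm⟩
  have hunit (x : GrothendieckGroup H) (ε : Bˣ) (hx : φ x = GrothendieckGroup.of (ε : B)) :
      ∃ η : Tˣ, ((η : T) : GrothendieckGroup H) = x := by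
    have hinv : φ x⁻¹ = GrothendieckGroup.of ((ε⁻¹ : Bˣ) : B) := by
      rw [map_inv, hx, inv_eq_iff_mul_eq_one, ← map_mul, Units.mul_inv, map_one]
    exact ⟨⟨⟨x, _, hx.symm⟩, ⟨x⁻¹, _, hinv.symm⟩, Subtype.ext (mul_inv_cancel x),
      Subtype.ext (inv_mul_cancel x)⟩, rfl⟩
  refine ⟨T, hT, isRootClosed_iff.2 fun x n hn hx => ?_,
    ⟨?_, fun a => ⟨fun h => ?_, fun h => h.map _⟩, ?_⟩⟩
  · have hx' : φ (x ^ n) ∈ image B := hx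
    rw [map_pow] at hx'
    exact isRootClosed_iff.1 hB _ n hn hx'
  · rintro ⟨x, b, hb⟩
    obtain ⟨a, ε, rfl⟩ := hθ.exists_mul_unit b
    obtain ⟨η, hη⟩ := hunit (x / GrothendieckGroup.of a) ε (by
      rw [map_div, hφ, ← hb, map_mul, mul_div_cancel_left])
    refine ⟨a, η, Subtype.ext ?_⟩
    change x = GrothendieckGroup.of a * ((η : T) : GrothendieckGroup H)
    rw [hη, mul_div_cancel]
  · refine (hθ.isUnit_iff a).1 ?_
    obtain ⟨⟨y, b, hb⟩, h⟩ := isUnit_iff_exists_inv.1 h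
    have h' : GrothendieckGroup.of a * y = 1 := congrArg Subtype.val h
    refine IsUnit.of_mul_eq_one b (of_injective B ?_)
    rw [map_mul, hb, ← hφ, ← map_mul, h', map_one, map_one]
  · rintro u ⟨x, b, hb⟩ ⟨y, c, hc⟩ h
    have h' : GrothendieckGroup.of u = x * y := congrArg Subtype.val h
    obtain ⟨v, w, ε, η, huvw, hv, hw⟩ := hθ.lift_mul u b c (of_injective B (by
      rw [← hφ, h', map_mul, map_mul, hb, hc]))
    obtain ⟨ε', hε⟩ := hunit (GrothendieckGroup.of v / x) ε (by
      rw [map_div, hφ, hv, ← hb, map_mul, mul_div_cancel_left])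
    obtain ⟨η', hη⟩ := hunit (GrothendieckGroup.of w / y) η (by
      rw [map_div, hφ, hw, ← hc, map_mul, mul_div_cancel_left])
    refine ⟨v, w, ε', η', huvw, Subtype.ext ?_, Subtype.ext ?_⟩
    · change GrothendieckGroup.of v = x * ((ε' : T) : GrothendieckGroup H)
      rw [hε, mul_div_cancel]
    · change GrothendieckGroup.of w = y * ((η' : T) : GrothendieckGroup H)
      rw [hη, mul_div_cancel]

theorem isTransferKrull_of_isRootClosed {H : Type u} [CommMonoid H]
    (hH : IsSNoetherian H) {T : Submonoid (GrothendieckGroup H)} {hT : IsOvermonoid H T}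
    (hroot : IsRootClosed T) (hθ : IsTransferHom (inclusion T hT)) :
    IsTransferKrull.{u, v} H := by
  -- The lift only serves to place the Krull monoid in the universe `max u v`.
  have e : T ≃* ULift.{v} T := MulEquiv.ulift.symm
  have hcomp := (isTransferHom_mulEquiv e).comp hθ
  have hs := hcomp.isSNoetherian hH
  have hcancel : IsCancelMul (ULift.{v} T) := e.symm.injective.isCancelMul e.symm (map_mul e.symm)
  refine ⟨ULift.{v} T, inferInstance, hcancel, _,
    ⟨hs.isCompletelyIntegrallyClosed fun a b t n hn h => ?_, hs.isMori⟩, hcomp⟩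
  have h' : ((e.symm a : T) : GrothendieckGroup H) ^ n =
      (e.symm b : GrothendieckGroup H) ^ n * (e.symm t : GrothendieckGroup H) := by
    simpa using congrArg (fun z => ((e.symm z : T) : GrothendieckGroup H)) h
  have hmem : ((e.symm a : T) : GrothendieckGroup H) / (e.symm b : T) ∈ T := by
    refine isRootClosed_iff.1 hroot _ n hn ?_
    rw [div_pow, h', mul_div_cancel_left]
    exact (e.symm t).2
  refine ⟨e ⟨_, hmem⟩, e.symm.injective (Subtype.ext ?_)⟩
  simp

end TransferKrull

open TransferKrull in
theorem mainTheorem7 (H : Type u) [CommMonoid H] [IsCancelMul H]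
    (hH : TransferKrull.IsSNoetherian H) :
    List.TFAE [
      TransferKrull.IsTransferKrull.{u, v} H,
      ∃ (T : Submonoid (Algebra.GrothendieckGroup H)) (hT : TransferKrull.IsOvermonoid H T),
        TransferKrull.IsRootClosed T ∧
          TransferKrull.IsTransferHom (TransferKrull.inclusion T hT),
      ∃ (T : Submonoid (Algebra.GrothendieckGroup H)) (hT : TransferKrull.IsOvermonoid H T),
        TransferKrull.IsInertInRootClosure T ∧
          TransferKrull.IsTransferHom (TransferKrull.inclusion T hT)] := by
  tfae_have 1 → 2 := by
    rintro ⟨B, _, _, θ, hB, hθ⟩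
    exact hθ.exists_isRootClosed hB.completelyIntegrallyClosed.isRootClosed
  tfae_have 2 → 3 := fun ⟨T, hT, hroot, hθ⟩ => ⟨T, hT, hroot.isInertInRootClosure, hθ⟩
  tfae_have 3 → 2 := fun ⟨T, hT, hinert, hθ⟩ =>
    ⟨rootClosure T, le_trans hT (le_rootClosure T), isRootClosed_rootClosure T,
      hinert.isTransferHom.comp hθ⟩
  tfae_have 2 → 1 := fun ⟨_, _, hroot, hθ⟩ => isTransferKrull_of_isRootClosed hH hroot hθ
  tfae_finish
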